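/- A topological space $X$ has countable tightness if for every $A\subseteq X$ the closure $\overline{A}$ equals the union of the closures of all countable subsets of $A$; otherwise it has uncountable tightness. $X$ is a $k$-space if every $C\subseteq X$ such that $C\cap K$ is closed in $K$ for each compact $K\subseteq X$ is closed in $X$. Topological vector spaces are real and Hausdorff. (1) For an uncountable cardinal $\kappa$, let $\mathbb V_\kappa=\bigoplus_{i<\kappa}\mathbb R$ carry its maximal (that is, finest) vector topology $\mu_\kappa$, and let $$\mathbb V_{\kappa,2}=\{(x_\alpha)_{\alpha<\kappa}\in\mathbb V_\kappa:\ |\{\alpha: x_\alpha\ne 0\}|\le 2,\ x_\alpha\in[-2,2]\text{ for all }\alpha<\kappa\}.$$ Then $\mathbb V_{\kappa,2}$ with the subspace topology induced by $\mu_\kappa$ has uncountable tightness. (2) Let $D$ be an uncountable discrete space and let $V(D)$, with the continuous map $i:D\to V(D)$, be the free topological vector space over $D$: for every continuous map $f$ from $D$ to a topological vector space $E$ there is a unique continuous linear operator $\overline f:V(D)\to E$ with $f=\overline f\circ i$. Let $$\mathrm{sp}_2(D)=\{\lambda_1 i(x_1)+\lambda_2 i(x_2):\ \lambda_1,\lambda_2\in[-2,2],\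 x_1,x_2\in D\}\subseteq V(D)$$ with the subspace topology. Then $\mathrm{sp}_2(D)$ and $V(D)$ both have uncountable tightness, and neither $\mathrm{sp}_2(D)$ nor $V(D)$ is a $k$-space. -/

import Mathlib

open Set Topology Cardinal

universe u v

/-- A space is of countable tightness if the closure of every subset `A` is the union of the
closures of the countable subsets of `A`. -/
def CountableTightness (X : Type*) [TopologicalSpace X] : Prop :=
  ∀ A : Set X, closure A = ⋃ B ∈ {B : Set X | B ⊆ A ∧ B.Countable}, closure B

/-- The level `𝕍_{κ,n}` of the direct sum `⨁_{i ∈ ι} ℝ` (`#ι = κ`, realised as `ι →₀ ℝ`): vectors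
with at most `n` nonzero coordinates, all of them lying in `[-n, n]`. -/
def directSumLevel (ι : Type*) (n : ℕ) : Set (ι →₀ ℝ) :=
  {x | x.support.card ≤ n ∧ ∀ a, x a ∈ Icc (-(n : ℝ)) n}

/-- `i : X → V` exhibits the (Hausdorff) real topological vector space `V` as the free topological
vector space over `X`: `i` is continuous and every continuous map from `X` to a (Hausdorff) real
topological vector space factors through `i` by a unique continuous linear operator. -/
structure IsFreeTVS {X V : Type u} [TopologicalSpace X] [AddCommGroup V] [Module ℝ V]
    [TopologicalSpace V] (i : X → V) : Prop where
  isTopologicalAddGroup : IsTopologicalAddGroup V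
  continuousSMul : ContinuousSMul ℝ V
  t2Space : T2Space V
  continuous : Continuous i
  existsUnique_lift : ∀ (E : Type u) [AddCommGroup E] [Module ℝ E] [TopologicalSpace E]
    [IsTopologicalAddGroup E] [ContinuousSMul ℝ E] [T2Space E] (f : X → E), Continuous f →
    ∃! F : V →L[ℝ] E, ∀ x, F (i x) = f x

/-- `sp_n(X) = {λ₁ x₁ + ⋯ + λₙ xₙ : λⱼ ∈ [-n, n], xⱼ ∈ X}` inside `V`, where `X` is mapped to `V`
by `i`. The points `xⱼ` need not be distinct. -/
def spLevel {X V : Type*} [AddCommGroup V] [Module ℝ V] (i : X → V) (n : ℕ) : Set V :=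
  {v | ∃ (l : Fin n → ℝ) (x : Fin n → X),
    (∀ j, l j ∈ Icc (-(n : ℝ)) n) ∧ v = ∑ j, l j • i (x j)}

/-- Free topological vector spaces over discrete spaces exist. -/
theorem exists_isFreeTVS (D : Type u) [TopologicalSpace D] [DiscreteTopology D] :
    letI : TopologicalSpace (D →₀ ℝ) := moduleTopology ℝ (D →₀ ℝ)
    IsFreeTVS (fun d : D => Finsupp.single d (1 : ℝ)) := by
  letI : TopologicalSpace (D →₀ ℝ) := moduleTopology ℝ (D →₀ ℝ)
  haveI : IsModuleTopology ℝ (D →₀ ℝ) := ⟨rfl⟩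
  have hg : IsTopologicalAddGroup (D →₀ ℝ) := IsModuleTopology.topologicalAddGroup ℝ _
  have hs : ContinuousSMul ℝ (D →₀ ℝ) := IsModuleTopology.toContinuousSMul ℝ _
  refine ⟨hg, hs, ?_, continuous_of_discreteTopology, ?_⟩
  · refine T2Space.of_injective_continuous (f := fun (x : D →₀ ℝ) (d : D) => x d)
      DFunLike.coe_injective ?_
    exact continuous_pi fun d =>
      IsModuleTopology.continuous_of_linearMap (Finsupp.lapply d : (D →₀ ℝ) →ₗ[ℝ] ℝ)
  · intro E _ _ _ _ _ _ f _
    refine ⟨⟨Finsupp.linearCombination ℝ f,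
      IsModuleTopology.continuous_of_linearMap _⟩, fun x => ?_, fun G hG => ?_⟩
    · simp
    · apply ContinuousLinearMap.coe_injective
      apply Finsupp.lhom_ext'
      intro d
      ext
      simpa using hG d

/-! Label `ℵ₁` basis vectors `e a` by distinct reals `g a` in `[0, 1]`; the vectors `|g a - g b| •
(e a + e b)`, `a ≠ b`, form one set that serves for every claim. Uncountability gives two labels
arbitrarily close relative to any neighbourhood of `0`, so `0` is in the closure but not in the set.
Yet continuous gauges with arbitrary weights keep `0` out of the closure of each countable subset,
and allow each compact set only finitely many of the vectors. All of these lie in the second level,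
so the argument applies both there and in the whole space. -/

/-- Every weight function on the index set is realised by a continuous gauge on `V` that
bounds the weighted coefficients of the vectors `c • (e a + e b)`. -/
def HasWeightGauges {S V : Type*} [AddCommGroup V] [Module ℝ V] [TopologicalSpace V]
    (e : S → V) : Prop :=
  ∀ w : S → ℝ, ∃ p : V → ℝ, Continuous p ∧ p 0 = 0 ∧
    ∀ a b c, a ≠ b → |c * w a| ≤ p (c • (e a + e b))

/-- The vectors `|g a - g b| • (e a + e b)` with `a ≠ b`. -/
def pairSet {S V : Type*} [AddCommGroup V] [Module ℝ V] (e : S → V) (g : S → ℝ) : Set V :=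
  {v | ∃ a b, a ≠ b ∧ v = |g a - g b| • (e a + e b)}

/-- On a countable set every function of two variables is dominated by a function of one of
them. -/
theorem Set.Countable.exists_dominating {S : Type*} {T : Set S} (hT : T.Countable)
    (h : S → S → ℝ) : ∃ w : S → ℝ, ∀ a ∈ T, ∀ b ∈ T, h a b ≤ w a ∨ h a b ≤ w b := by
  obtain ⟨k, hk⟩ := Set.countable_iff_exists_injOn.1 hT
  have bound : ∀ a, ∃ M, ∀ i ∈ T, k i ≤ k a → h i a ≤ M ∧ h a i ≤ M := by
    intro a
    have hfin : {i | i ∈ T ∧ k i ≤ k a}.Finite := by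
      refine Set.Finite.of_injOn (f := k) (t := Set.Iic (k a)) (fun i hi => hi.2) ?_
        (Set.finite_Iic _)
      exact hk.mono fun i hi => hi.1
    obtain ⟨M, hM⟩ := (hfin.image fun i => max (h i a) (h a i)).bddAbove
    exact ⟨M, fun i hi hia => max_le_iff.1 (hM ⟨i, ⟨hi, hia⟩, rfl⟩)⟩
  choose w hw using bound
  refine ⟨w, fun a ha b hb => ?_⟩
  -- The index enumerated later dominates: only finitely many indices precede it.
  rcases le_total (k a) (k b) with hab | hba
  · exact Or.inr (hw b a ha hab).1
  · exact Or.inl (hw a b hb hba).2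

section PairSet

variable {S V : Type*} [AddCommGroup V] [Module ℝ V] [TopologicalSpace V] {e : S → V} {g : S → ℝ}

theorem zero_notMem_pairSet (he : HasWeightGauges e) (hg : Function.Injective g) :
    (0 : V) ∉ pairSet e g := by
  rintro ⟨a, b, hab, h⟩
  obtain ⟨p, -, hp0, hp⟩ := he fun _ => 1
  have h1 := hp a b |g a - g b| hab
  rw [← h, hp0, mul_one, abs_abs] at h1
  exact absurd h1 (not_le.2 (abs_pos.2 (sub_ne_zero.2 (hg.ne hab))))

theorem zero_mem_closure_pairSet [IsTopologicalAddGroup V] [ContinuousSMul ℝ V] [Uncountable S] :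
    (0 : V) ∈ closure (pairSet e g) := by
  rw [mem_closure_iff_nhds]
  intro U hU
  obtain ⟨W, hW, hWU⟩ := exists_nhds_zero_half hU
  have small : ∀ a, ∃ n : ℕ, ∀ t : ℝ, |t| < 1 / ((n : ℝ) + 1) → t • e a ∈ W := by
    intro a
    have hc : Continuous fun t : ℝ => t • e a := continuous_id.smul continuous_const
    have hm : (fun t : ℝ => t • e a) ⁻¹' W ∈ 𝓝 (0 : ℝ) :=
      hc.continuousAt.preimage_mem_nhds (by simpa using hW)
    obtain ⟨ε, hε, hb⟩ := Metric.mem_nhds_iff.1 hm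
    obtain ⟨n, hn⟩ := exists_nat_one_div_lt hε
    exact ⟨n, fun t ht => hb (by simpa using ht.trans hn)⟩
  choose n hn using small
  -- Pigeonhole: uncountably many indices, countably many pairs (tolerance, cell of width `1 / (n +
  -- 1)` containing `g a`).
  obtain ⟨a, b, hab, hne⟩ : ∃ a b : S,
      ((n a, ⌊g a * (n a + 1)⌋) : ℕ × ℤ) = (n b, ⌊g b * (n b + 1)⌋) ∧ a ≠ b := by
    by_contra! hinj
    exact not_countable (α := S) (Function.Injective.countable
      (f := fun a => ((n a, ⌊g a * (n a + 1)⌋) : ℕ × ℤ)) fun a b => hinj a b)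
  obtain ⟨hnab, hfl⟩ := Prod.mk.inj hab
  rw [← hnab] at hfl
  have hpos : (0 : ℝ) < (n a : ℝ) + 1 := by positivity
  have hlt : |g a - g b| < 1 / ((n a : ℝ) + 1) := by
    have := Int.abs_sub_lt_one_of_floor_eq_floor hfl
    rw [← sub_mul, abs_mul, abs_of_pos hpos] at this
    rwa [lt_div_iff₀ hpos]
  refine ⟨_, ?_, a, b, hne, rfl⟩
  rw [smul_add]
  exact hWU _ (hn a _ (by rwa [abs_abs])) _ (hn b _ (by rwa [abs_abs, ← hnab]))

/-- Countably many vectors involve countably many indices, so `1 / |g s - g t|` is dominated by a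
weight of one variable. Its gauge is at least `1` on `B` and vanishes at `0`. -/
theorem zero_notMem_closure_of_countable_subset_pairSet (he : HasWeightGauges e)
    (hg : Function.Injective g) {B : Set V} (hB : B ⊆ pairSet e g) (hBc : B.Countable) :
    (0 : V) ∉ closure B := by
  have hrep : ∀ x : B, ∃ a b, a ≠ b ∧ (x : V) = |g a - g b| • (e a + e b) := fun x => hB x.2
  choose a b hab hx using hrep
  have : Countable B := hBc
  obtain ⟨w, hw⟩ := ((Set.countable_range a).union (Set.countable_range b)).exists_dominating
    fun s t => 1 / |g s - g t|
  obtain ⟨p, hpc, hp0, hp⟩ := he w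
  have key : B ⊆ {x | 1 ≤ p x} := by
    intro x hxB
    have hpos : 0 < |g (a ⟨x, hxB⟩) - g (b ⟨x, hxB⟩)| :=
      abs_pos.2 (sub_ne_zero.2 (hg.ne (hab _)))
    have hv := hx ⟨x, hxB⟩
    change x = _ at hv
    change 1 ≤ p x
    rcases hw _ (Or.inl ⟨⟨x, hxB⟩, rfl⟩) _ (Or.inr ⟨⟨x, hxB⟩, rfl⟩) with h | h <;>
      rw [div_le_iff₀' hpos] at h
    · rw [hv]
      exact (h.trans (le_abs_self _)).trans (hp _ _ _ (hab _))
    · rw [hv, add_comm]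
      exact (h.trans (le_abs_self _)).trans (hp _ _ _ (hab _).symm)
  intro h0
  have h1 := closure_minimal key (isClosed_le continuous_const hpc) h0
  change 1 ≤ p 0 at h1
  rw [hp0] at h1
  exact absurd h1 (by norm_num)

theorem finite_pairSet_inter_of_isCompact (he : HasWeightGauges e) (hg : Function.Injective g)
    {K : Set V} (hK : IsCompact K) : (pairSet e g ∩ K).Finite := by
  let T : Set S := {a | ∃ b, a ≠ b ∧ |g a - g b| • (e a + e b) ∈ K}
  have hT : T.Finite := by
    by_contra hinf
    let u : ℕ ↪ T := Set.Infinite.natEmbedding T hinf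
    have hu : ∀ n, ∃ b, (u n : S) ≠ b ∧ |g (u n) - g b| • (e (u n) + e b) ∈ K := fun n => (u n).2
    choose b hne hmem using hu
    have hinj : Function.Injective fun n => (u n : S) := Subtype.val_injective.comp u.injective
    -- The weight cancels the coefficient, so the gauge is at least `n` at the `n`-th vector and
    -- unbounded on `K`.
    obtain ⟨p, hpc, -, hp⟩ :=
      he (Function.extend (fun n => (u n : S)) (fun n => (n : ℝ) / |g (u n) - g (b n)|) 0)
    obtain ⟨M, hM⟩ := hK.bddAbove_image hpc.continuousOn
    obtain ⟨n, hn⟩ := exists_nat_gt M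
    have hpos : 0 < |g (u n) - g (b n)| := abs_pos.2 (sub_ne_zero.2 (hg.ne (hne n)))
    have h1 := hp (u n) (b n) |g (u n) - g (b n)| (hne n)
    rw [hinj.extend_apply, mul_div_cancel₀ _ hpos.ne', Nat.abs_cast] at h1
    exact absurd (h1.trans (hM ⟨_, hmem n, rfl⟩)) (not_le.2 hn)
  -- The vectors are symmetric in `a` and `b`, so both indices lie in `T`.
  refine ((hT.prod hT).image fun q : S × S => |g q.1 - g q.2| • (e q.1 + e q.2)).subset ?_
  rintro _ ⟨⟨a, b, hab, rfl⟩, hv⟩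
  refine ⟨(a, b), ⟨⟨b, hab, hv⟩, a, hab.symm, ?_⟩, rfl⟩
  rwa [abs_sub_comm, add_comm]

variable {X : Type*} [TopologicalSpace X] {j : X → V}

theorem zero_mem_closure_preimage_pairSet [IsTopologicalAddGroup V] [ContinuousSMul ℝ V]
    [Uncountable S] (hj : IsInducing j) (hr : pairSet e g ⊆ range j) {x₀ : X} (hx₀ : j x₀ = 0) :
    x₀ ∈ closure (j ⁻¹' pairSet e g) := by
  rw [hj.closure_eq_preimage_closure_image, mem_preimage, image_preimage_eq_of_subset hr, hx₀]
  exact zero_mem_closure_pairSet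

theorem not_countableTightness_of_pairSet_subset_range [IsTopologicalAddGroup V]
    [ContinuousSMul ℝ V] [Uncountable S] (he : HasWeightGauges e) (hg : Function.Injective g)
    (hj : IsInducing j) (hr : pairSet e g ⊆ range j) {x₀ : X} (hx₀ : j x₀ = 0) :
    ¬ CountableTightness X := by
  intro h
  have hmem := zero_mem_closure_preimage_pairSet hj hr hx₀
  rw [h] at hmem
  simp only [mem_iUnion] at hmem
  obtain ⟨B, ⟨hB, hBc⟩, hxB⟩ := hmem
  rw [hj.closure_eq_preimage_closure_image, mem_preimage, hx₀] at hxB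
  exact zero_notMem_closure_of_countable_subset_pairSet he hg (image_subset_iff.2 hB)
    (hBc.image j) hxB

theorem not_compactlyCoherentSpace_of_pairSet_subset_range [IsTopologicalAddGroup V]
    [ContinuousSMul ℝ V] [T2Space V] [Uncountable S] (he : HasWeightGauges e)
    (hg : Function.Injective g) (hj : IsEmbedding j) (hr : pairSet e g ⊆ range j)
    {x₀ : X} (hx₀ : j x₀ = 0) : ¬ CompactlyCoherentSpace X := by
  intro h
  have : T2Space X := hj.t2Space
  have hmem := zero_mem_closure_preimage_pairSet hj.isInducing hr hx₀
  have hcl : IsClosed (j ⁻¹' pairSet e g) := by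
    rw [CompactlyCoherentSpace.isClosed_iff]
    intro K hK
    have hfin : (j ⁻¹' pairSet e g ∩ K).Finite := by
      refine Set.Finite.of_injOn (f := j) ?_ hj.injective.injOn
        (finite_pairSet_inter_of_isCompact he hg (hK.image hj.continuous))
      exact fun x hx => ⟨hx.1, x, hx.2, rfl⟩
    refine Set.Finite.isClosed ?_
    exact Set.Finite.of_injOn (f := Subtype.val) (t := j ⁻¹' pairSet e g ∩ K)
      (fun x hx => ⟨hx, x.2⟩) Subtype.val_injective.injOn hfin
  rw [hcl.closure_eq, mem_preimage, hx₀] at hmem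
  exact zero_notMem_pairSet he hg hmem

end PairSet

/-- `D` may exceed the continuum; a subset of size `ℵ₁` always injects into `[0, 1]`. -/
theorem Uncountable.exists_set_injective_unitInterval (D : Type*) [Uncountable D] :
    ∃ (S : Set D) (g : S → ℝ), Uncountable S ∧ Function.Injective g ∧ ∀ a, g a ∈ Icc (0 : ℝ) 1 := by
  have h1 : ℵ₁ ≤ #D := aleph_one_le_iff.2 (aleph0_lt_mk_iff.2 inferInstance)
  obtain ⟨S, hS⟩ := le_mk_iff_exists_set.1 h1
  have h2 : lift.{0} #S ≤ lift #(Icc (0 : ℝ) 1) := by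
    rw [mk_Icc_real zero_lt_one, hS]
    simpa using aleph_one_le_continuum
  obtain ⟨f⟩ := lift_mk_le'.1 h2
  refine ⟨S, fun a => f a, ?_, Subtype.val_injective.comp f.injective, fun a => (f a).2⟩
  rw [← aleph0_lt_mk_iff, ← aleph_one_le_iff, hS]

theorem IsFreeTVS.hasWeightGauges {D V : Type u} [TopologicalSpace D] [DiscreteTopology D]
    [AddCommGroup V] [Module ℝ V] [TopologicalSpace V] {i : D → V} (hi : IsFreeTVS i) (S : Set D) :
    HasWeightGauges fun a : S => i a := by
  classical
  intro w
  -- Send `d` to `w d` times the unit vector of `ℓ¹(D)`, with weight `0` off `S`; the norm bounds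
  -- each coordinate.
  obtain ⟨F, hF, -⟩ := hi.existsUnique_lift (lp (fun _ : D => ℝ) 1)
    (fun d => lp.single 1 d (Function.extend Subtype.val w 0 d)) continuous_of_discreteTopology
  refine ⟨fun v => ‖F v‖, F.continuous.norm, by simp, fun a b c hab => ?_⟩
  have h := lp.norm_apply_le_norm one_ne_zero (F (c • (i a + i b))) (a : D)
  refine le_trans (le_of_eq ?_) h
  have hab' : (a : D) ≠ b := fun h => hab (Subtype.ext h)
  rw [map_smul, map_add, hF, hF, Subtype.val_injective.extend_apply,
    Subtype.val_injective.extend_apply]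
  change |c * w a| = |c * (Pi.single (M := fun _ : D => ℝ) (a : D) (w a) a +
    Pi.single (M := fun _ : D => ℝ) (b : D) (w b) a)|
  rw [Pi.single_eq_same, Pi.single_eq_of_ne hab', add_zero]

theorem abs_sub_mem_Icc_neg_two_two {x y : ℝ} (hx : x ∈ Icc (0 : ℝ) 1) (hy : y ∈ Icc (0 : ℝ) 1) :
    |x - y| ∈ Icc (-((2 : ℕ) : ℝ)) (2 : ℕ) := by
  obtain ⟨hx0, hx1⟩ := hx
  obtain ⟨hy0, hy1⟩ := hy
  have h : |x - y| ≤ 1 := abs_le.2 ⟨by linarith, by linarith⟩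
  have h0 := abs_nonneg (x - y)
  push_cast
  exact ⟨by linarith, by linarith⟩

theorem zero_mem_spLevel {X V : Type*} [AddCommGroup V] [Module ℝ V] [Nonempty X] (i : X → V)
    (n : ℕ) : (0 : V) ∈ spLevel i n :=
  ⟨0, fun _ => Classical.arbitrary X, fun _ => by simp, by simp⟩

theorem pairSet_subset_spLevel {D V : Type*} [AddCommGroup V] [Module ℝ V] (i : D → V)
    {S : Set D} {g : S → ℝ} (hg : ∀ a, g a ∈ Icc (0 : ℝ) 1) :
    pairSet (fun a : S => i a) g ⊆ spLevel i 2 := by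
  rintro _ ⟨a, b, -, rfl⟩
  exact ⟨fun _ => |g a - g b|, ![(a : D), b],
    fun _ => abs_sub_mem_Icc_neg_two_two (hg a) (hg b), by simp⟩

theorem pairSet_subset_directSumLevel {D : Type*} {S : Set D} {g : S → ℝ}
    (hg : ∀ a, g a ∈ Icc (0 : ℝ) 1) :
    pairSet (fun a : S => Finsupp.single (a : D) (1 : ℝ)) g ⊆ directSumLevel D 2 := by
  classical
  rintro _ ⟨a, b, hab, rfl⟩
  have hab' : (a : D) ≠ b := fun h => hab (Subtype.ext h)
  constructor
  · refine (Finset.card_le_card (t := {(a : D), (b : D)}) fun d hd => ?_).trans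
      Finset.card_le_two
    by_contra hd'
    simp only [Finset.mem_insert, Finset.mem_singleton, not_or] at hd'
    rw [Finsupp.mem_support_iff] at hd
    exact hd (by simp [Ne.symm hd'.1, Ne.symm hd'.2])
  · intro d
    have hc := abs_sub_mem_Icc_neg_two_two (hg a) (hg b)
    by_cases hda : (a : D) = d
    · subst hda
      simpa [Finsupp.single_apply, hab'.symm] using hc
    · by_cases hdb : (b : D) = d
      · subst hdb
        simpa [Finsupp.single_apply, hab'] using hc
      · simp [hda, hdb]

theorem lemma3p6 :
    -- the level of the direct sum of `κ` lines; `moduleTopology` is the finest vector topology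
    (∀ (κ : Cardinal.{u}) (_ : ℵ₀ < κ) (ι : Type u) (_ : #ι = κ),
      letI : TopologicalSpace (ι →₀ ℝ) := moduleTopology ℝ (ι →₀ ℝ)
      ¬ CountableTightness (directSumLevel ι 2)) ∧
    -- the free topological vector space over an uncountable discrete space
    (∀ (D : Type v) [TopologicalSpace D] [DiscreteTopology D] [Uncountable D]
      (V : Type v) [AddCommGroup V] [Module ℝ V] [TopologicalSpace V] (i : D → V),
      IsFreeTVS i →
        ¬ CountableTightness (spLevel i 2) ∧
        ¬ CountableTightness V ∧
        ¬ CompactlyCoherentSpace (spLevel i 2) ∧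
        ¬ CompactlyCoherentSpace V) := by
  constructor
  · intro κ hκ ι hι
    let : TopologicalSpace (ι →₀ ℝ) := moduleTopology ℝ (ι →₀ ℝ)
    let : TopologicalSpace ι := ⊥
    have : DiscreteTopology ι := ⟨rfl⟩
    have : Uncountable ι := aleph0_lt_mk_iff.1 (hι ▸ hκ)
    have hi := exists_isFreeTVS ι
    have := hi.isTopologicalAddGroup
    have := hi.continuousSMul
    obtain ⟨S, g, hS, hg, hg01⟩ := Uncountable.exists_set_injective_unitInterval ι
    exact not_countableTightness_of_pairSet_subset_range (hi.hasWeightGauges S) hg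
      IsInducing.subtypeVal (by simpa using pairSet_subset_directSumLevel hg01)
      (x₀ := ⟨0, by simp [directSumLevel]⟩) rfl
  · intro D _ _ _ V _ _ _ i hi
    have := hi.isTopologicalAddGroup
    have := hi.continuousSMul
    have := hi.t2Space
    obtain ⟨S, g, hS, hg, hg01⟩ := Uncountable.exists_set_injective_unitInterval D
    have he := hi.hasWeightGauges S
    have hsp : pairSet (fun a : S => i a) g ⊆ range (Subtype.val : spLevel i 2 → V) := by
      simpa using pairSet_subset_spLevel i hg01
    have hV : pairSet (fun a : S => i a) g ⊆ range (id : V → V) := by simp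
    exact ⟨not_countableTightness_of_pairSet_subset_range he hg IsInducing.subtypeVal hsp
        (x₀ := ⟨0, zero_mem_spLevel i 2⟩) rfl,
      not_countableTightness_of_pairSet_subset_range he hg IsInducing.id hV rfl,
      not_compactlyCoherentSpace_of_pairSet_subset_range he hg IsEmbedding.subtypeVal hsp
        (x₀ := ⟨0, zero_mem_spLevel i 2⟩) rfl,
      not_compactlyCoherentSpace_of_pairSet_subset_range he hg IsEmbedding.id hV rfl⟩
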